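/- Let $M$ be a finite nonempty distributive lattice with least element $0$. Regard $M$ as the commutative monoid $(M,\vee,0)$, equivalently as a semimodule over the Boolean semiring $\mathbf B=\{0,1\}$ (with $1+1=1$). Let $\mathrm{End}(M)$ be the semiring of all its endomorphisms, i.e. of all maps $f\colon M\to M$ with $f(0)=0$ and $f(x\vee y)=f(x)\vee f(y)$, with pointwise join as addition and composition $(fg)(x)=f(g(x))$ as multiplication. A semiring $S$ is called a right CP-semiring if every cyclic right $S$-semimodule, i.e. every homomorphic image of the right semimodule $S_S$, is projective, i.e. a retract of a free right $S$-semimodule. Let $T(M)$ be the set of all $m\in M$ such that every $x\in M$ satisfies $x\le m$ or $m\le x$, and for $a\le b$ in $M$ put $[a,b]=\{x\in M: a\le x\le b\}$. Then the following conditions are equivalent: 1. $\mathrm{End}(M)$ is a right CP-semiring. 2. For every congruence $\theta$ of the semimodule $(M,\vee,0)$ (i.e. every equivalence relation on $M$ compatible with $\vee$), the quotient $M/\theta$, ordered by $x\le y\iff x\vee y=y$, is a distributive lattice. 3. For all $t\le t'$ in $T(M)$ with $[t,t']\cap T(M)=\{t,t'\}$, either $[t,t']=\{t,t'\}$ or $[t,t']$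 is isomorphic, as a lattice, to $\mathbf B^2$, where $\mathbf B=\{0<1\}$ is the two-element lattice. -/

import Mathlib

universe u

/-- The Boolean semiring `{0, 1}` with `1 + 1 = 1`: addition is `or`, multiplication is `and`. -/
def BoolSemiring : Type := Bool

instance BoolSemiring.instCommSemiring : CommSemiring BoolSemiring where
  add a b := or a b
  zero := false
  mul a b := and a b
  one := true
  add_assoc := Bool.or_assoc
  zero_add := Bool.false_or
  add_zero := Bool.or_false
  add_comm := Bool.or_comm
  mul_assoc := Bool.and_assoc
  one_mul := Bool.true_and
  mul_one := Bool.and_true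
  zero_mul := Bool.false_and
  mul_zero := Bool.and_false
  mul_comm := Bool.and_comm
  left_distrib := Bool.and_or_distrib_left
  right_distrib := Bool.and_or_distrib_right
  nsmul := @nsmulRec BoolSemiring ⟨false⟩ ⟨or⟩
  npow := @npowRec BoolSemiring ⟨true⟩ ⟨and⟩

/-- A join-semilattice `M` with least element, regarded as a commutative monoid `(M, ∨, ⊥)`
and as a semimodule over the Boolean semiring. -/
def JoinSemimodule (M : Type u) : Type u := M

namespace JoinSemimodule

instance instAddCommMonoid (M : Type u) [SemilatticeSup M] [OrderBot M] :
    AddCommMonoid (JoinSemimodule M) where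
  add a b := (a ⊔ b : M)
  zero := (⊥ : M)
  add_assoc := sup_assoc (α := M)
  zero_add := bot_sup_eq (α := M)
  add_zero := sup_bot_eq (α := M)
  add_comm := sup_comm (α := M)
  nsmul := @nsmulRec M ⟨(⊥ : M)⟩ ⟨(· ⊔ ·)⟩

/-- `0 • x = ⊥` and `1 • x = x`. -/
instance instModule (M : Type u) [SemilatticeSup M] [OrderBot M] :
    Module BoolSemiring (JoinSemimodule M) where
  smul b x := Bool.rec (⊥ : M) x b
  one_smul _ := rfl
  mul_smul a b x := by cases a <;> cases b <;> rfl
  smul_zero a := by cases a <;> rfl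
  zero_smul _ := rfl
  smul_add a x y := by
    cases a
    · exact (bot_sup_eq (⊥ : M)).symm
    · rfl
  add_smul a b x := by
    cases a <;> cases b
    · exact (bot_sup_eq (⊥ : M)).symm
    · exact (bot_sup_eq (α := M) x).symm
    · exact (sup_bot_eq (α := M) x).symm
    · exact (sup_idem (α := M) x).symm

end JoinSemimodule

/-- `S` is a right CP-semiring: every cyclic right `S`-semimodule (homomorphic image of the
regular right semimodule `S`) is projective. Right `S`-semimodules are `Sᵐᵒᵖ`-modules. As a cyclic
semimodule is a quotient of `S`, it is enough to quantify over the universe of `S`. -/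
def IsRightCPSemiring (S : Type u) [Semiring S] : Prop :=
  ∀ (A : Type u) [AddCommMonoid A] [Module Sᵐᵒᵖ A],
    (∃ f : S →ₗ[Sᵐᵒᵖ] A, Function.Surjective f) → Module.Projective Sᵐᵒᵖ A

/-- The (additively idempotent) commutative monoid `A`, ordered by `a ≤ b ↔ a + b = b`,
is a distributive lattice; that is, `+` is the join of a distributive lattice. -/
def IsDistribLatticeUnderAdd (A : Type u) [AddCommMonoid A] : Prop :=
  ∃ _ : DistribLattice A, ∀ a b : A, a ⊔ b = a + b

/-- `T(M)`: the elements comparable to all elements of `M`. -/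
def comparableElements (M : Type u) [LE M] : Set M :=
  {m | ∀ x : M, x ≤ m ∨ m ≤ x}

/-! 1 ⇔ 2: right congruences of `End(M)` correspond to congruences `θ` of `M`, with `f ~ g` iff `f x
θ g x` for all `x`. The maps `constEnd c` embed `M` additively in `End(M)`, and every `g` is the sum
of `constEnd (g j) * primeEnd j`, so a congruence is determined by its trace on constants. Splitting
`End(M) → End(M)/~` then amounts to splitting `M → M/θ`. Such a section exists iff `M/θ` is
distributive: refinement passes to retracts of `M`, and a finite distributive lattice is projective
because a section may be prescribed on its sup-primes.

2 ⇔ 3: both say that each element is incomparable to at most one other (`IncomparableUnique`). If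
this fails, some congruence has a pentagon as quotient. If it holds, incomparable `a`, `b` span a
square whose ends `a ⊓ b`, `a ⊔ b` are comparable to everything. -/

/-! ### Distributivity as a refinement property of addition -/

/-- The Riesz refinement property for an additively idempotent commutative monoid, with respect to
the order `a ≤ b ↔ a + b = b`. -/
def HasAddRefinement (A : Type*) [AddCommMonoid A] : Prop :=
  ∀ x a b : A, x + (a + b) = a + b → ∃ a' b', x = a' + b' ∧ a' + a = a ∧ b' + b = b

theorem IsDistribLatticeUnderAdd.hasAddRefinement {A : Type u} [AddCommMonoid A]
    (h : IsDistribLatticeUnderAdd A) : HasAddRefinement A := by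
  obtain ⟨L, hL⟩ := h
  intro x a b hx
  simp only [← hL] at hx ⊢
  refine ⟨x ⊓ a, x ⊓ b, ?_, sup_eq_right.2 inf_le_right, sup_eq_right.2 inf_le_right⟩
  rw [← inf_sup_left, inf_eq_left.2 (sup_eq_right.1 hx)]

/-- By finiteness, meets exist as joins of all common lower bounds; refining `a ⊓ (b ⊔ c)` below `b
⊔ c` gives the distributive inequality. -/
theorem HasAddRefinement.isDistribLatticeUnderAdd {A : Type u} [AddCommMonoid A] [Finite A]
    (hidem : ∀ a : A, a + a = a) (h : HasAddRefinement A) : IsDistribLatticeUnderAdd A := by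
  classical
  cases nonempty_fintype A
  let : Max A := ⟨(· + ·)⟩
  let : SemilatticeSup A := SemilatticeSup.mk' add_comm add_assoc hidem
  let : OrderBot A := { bot := 0, bot_le := fun a => zero_add a }
  let : Lattice A :=
    { (inferInstance : SemilatticeSup A) with
      inf := fun a b => (Finset.univ.filter fun c => c ≤ a ∧ c ≤ b).sup id
      inf_le_left := fun a b => Finset.sup_le fun c hc => (Finset.mem_filter.1 hc).2.1
      inf_le_right := fun a b => Finset.sup_le fun c hc => (Finset.mem_filter.1 hc).2.2
      le_inf := fun a b c hb hc =>
        Finset.le_sup (f := id) (Finset.mem_filter.2 ⟨Finset.mem_univ _, hb, hc⟩) }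
  refine ⟨DistribLattice.ofInfSupLe fun a b c => ?_, fun _ _ => rfl⟩
  obtain ⟨b', c', hx, hb, hc⟩ := h (a ⊓ (b ⊔ c)) b c (inf_le_right : a ⊓ (b ⊔ c) ≤ b ⊔ c)
  have hx' : a ⊓ (b ⊔ c) = b' ⊔ c' := hx
  have hle : b' ⊔ c' ≤ a := hx' ▸ inf_le_left
  rw [hx']
  exact sup_le_sup (le_inf (le_sup_left.trans hle) hb) (le_inf (le_sup_right.trans hle) hc)

/-! ### Sup-prime decomposition and projectivity of finite distributive lattices -/

section SupPrimeDecomposition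

variable {N : Type*} [AddCommMonoid N] [DistribLattice N] [OrderBot N]

theorem Finset.sum_eq_sup_of_add_eq_sup {ι : Type*} (hadd : ∀ a b : N, a ⊔ b = a + b)
    (hbot : (⊥ : N) = 0) (s : Finset ι) (f : ι → N) : ∑ i ∈ s, f i = s.sup f := by
  classical
  induction s using Finset.induction_on with
  | empty => simp [hbot]
  | insert i s hi ih => rw [Finset.sum_insert hi, Finset.sup_insert, ih, hadd]

open Classical in
theorem sum_supPrime_and_le [Fintype N] (hadd : ∀ a b : N, a ⊔ b = a + b) (hbot : (⊥ : N) = 0)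
    (x : N) : ∑ j : N, (if SupPrime j ∧ j ≤ x then j else 0) = x := by
  rw [Finset.sum_eq_sup_of_add_eq_sup hadd hbot]
  apply le_antisymm
  · refine Finset.sup_le fun j _ => ?_
    split_ifs with h
    · exact h.2
    · exact hbot ▸ bot_le
  · obtain ⟨s, hs, hirr⟩ := exists_supIrred_decomposition x
    nth_rw 1 [← hs]
    refine Finset.sup_le fun j hj => ?_
    have hjx : SupPrime j ∧ j ≤ x := ⟨(hirr hj).supPrime, hs ▸ Finset.le_sup (f := id) hj⟩
    calc id j = if SupPrime j ∧ j ≤ x then j else 0 := (if_pos hjx).symm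
      _ ≤ _ := Finset.le_sup (f := fun j => if SupPrime j ∧ j ≤ x then j else 0)
        (Finset.mem_univ j)

end SupPrimeDecomposition

/-- A finite distributive lattice is a projective object among join-semilattices with zero. -/
theorem IsDistribLatticeUnderAdd.exists_addMonoidHom_section {A : Type*} {N : Type u}
    [AddCommMonoid A] [AddCommMonoid N] [Finite N] (hidem : ∀ a : A, a + a = a)
    (hN : IsDistribLatticeUnderAdd N) (q : A →+ N) (hq : Function.Surjective q) :
    ∃ φ : N →+ A, ∀ n, q (φ n) = n := by
  classical
  cases nonempty_fintype N
  obtain ⟨L, hL⟩ := hN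
  let : OrderBot N :=
    { bot := 0, bot_le := fun a => sup_eq_right.1 ((hL 0 a).trans (zero_add a)) }
  obtain ⟨r, hr⟩ := hq.hasRightInverse
  -- Sum the chosen lifts of the sup-primes below `n`. Additivity holds because a sup-prime lies
  -- below `a ⊔ b` iff it lies below `a` or `b`; idempotency of `A` absorbs those counted twice.
  refine ⟨⟨⟨fun n => ∑ j : N, if SupPrime j ∧ j ≤ n then r j else 0, ?_⟩, ?_⟩, fun n => ?_⟩
  · refine Finset.sum_eq_zero fun j _ => if_neg fun h => ?_
    exact h.1.ne_bot (le_bot_iff.1 h.2)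
  · intro a b
    dsimp only
    rw [← Finset.sum_add_distrib]
    refine Finset.sum_congr rfl fun j _ => ?_
    by_cases hj : SupPrime j
    · rw [← hL, hj.le_sup]
      by_cases ha : j ≤ a <;> by_cases hb : j ≤ b <;>
        simp only [hj, ha, hb, hidem, true_and, or_true, true_or, or_self, if_true, if_false,
          add_zero, zero_add]
    · simp only [hj, false_and, if_false, add_zero]
  · change q (∑ j : N, if SupPrime j ∧ j ≤ n then r j else 0) = n
    rw [map_sum]
    simp only [apply_ite q, map_zero, hr _]
    exact sum_supPrime_and_le hL rfl n

namespace JoinSemimodule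

variable {M : Type u} [DistribLattice M] [OrderBot M]

instance instDistribLattice : DistribLattice (JoinSemimodule M) :=
  inferInstanceAs (DistribLattice M)

instance instOrderBot : OrderBot (JoinSemimodule M) :=
  { bot := (⊥ : M), bot_le := fun _ => bot_le (α := M) }

instance instFinite [Finite M] : Finite (JoinSemimodule M) := inferInstanceAs (Finite M)

theorem add_self (a : JoinSemimodule M) : a + a = a := sup_idem (α := M) a

theorem add_eq_right {a b : JoinSemimodule M} : a + b = b ↔ a ≤ b := sup_eq_right (α := M)

theorem hasAddRefinement : HasAddRefinement (JoinSemimodule M) :=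
  IsDistribLatticeUnderAdd.hasAddRefinement ⟨inferInstance, fun _ _ => rfl⟩

end JoinSemimodule

/-- Additive maps are linear over the Boolean semiring. -/
def AddMonoidHom.toBoolLinearMap {A B : Type*} [AddCommMonoid A] [AddCommMonoid B]
    [Module BoolSemiring A] [Module BoolSemiring B] (f : A →+ B) : A →ₗ[BoolSemiring] B where
  __ := f
  map_smul' c x := by
    cases c
    · exact (congrArg f (zero_smul BoolSemiring x)).trans
        ((map_zero f).trans (zero_smul BoolSemiring (f x)).symm)
    · exact (congrArg f (one_smul BoolSemiring x)).trans (one_smul BoolSemiring (f x)).symm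

namespace ModuleCon

variable {R A : Type*} [Semiring R] [AddCommMonoid A] [Module R A] (θ : ModuleCon R A)

/-- The quotient map of a module congruence. -/
def mkQ : A →ₗ[R] θ.Quotient where
  toFun a := Quotient.mk θ.toSetoid a
  map_add' _ _ := rfl
  map_smul' _ _ := rfl

theorem mkQ_surjective : Function.Surjective θ.mkQ := Quotient.mk_surjective

theorem mkQ_eq_iff {a b : A} : θ.mkQ a = θ.mkQ b ↔ θ.r a b := Quotient.eq (r := θ.toSetoid)

end ModuleCon

instance ModuleCon.instFiniteQuotient {R A : Type*} [Semiring R] [AddCommMonoid A] [Module R A]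
    [Finite A] (θ : ModuleCon R A) : Finite θ.Quotient :=
  Finite.of_surjective _ θ.mkQ_surjective

/-- Refinement mentions only addition, so it transfers along additive maps that need not preserve
meets. -/
theorem HasAddRefinement.of_retract {A B : Type*} [AddCommMonoid A] [AddCommMonoid B]
    (h : HasAddRefinement B) (i : A →+ B) (q : B →+ A) (hq : ∀ a, q (i a) = a) :
    HasAddRefinement A := by
  intro x a b hx
  obtain ⟨a', b', h1, h2, h3⟩ := h (i x) (i a) (i b) (by simp only [← map_add, hx])
  refine ⟨q a', q b', ?_, ?_, ?_⟩
  · rw [← map_add, ← h1, hq]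
  · simpa only [map_add, hq] using congrArg q h2
  · simpa only [map_add, hq] using congrArg q h3

/-! ### Congruences of `M` and right congruences of its endomorphism semiring -/

namespace JoinSemimodule

variable {M : Type u} [DistribLattice M] [OrderBot M]

variable (M) in
/-- The semiring of all endomorphisms of the join-semilattice `M` with zero. -/
abbrev EndSemiring : Type u := Module.End BoolSemiring (JoinSemimodule M)

open Classical in
/-- The endomorphism sending every nonzero element to `c`. -/
noncomputable def constEnd : JoinSemimodule M →+ EndSemiring M where
  toFun c := AddMonoidHom.toBoolLinearMap
    { toFun x := if x = ⊥ then 0 else c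
      map_zero' := if_pos rfl
      map_add' x y := by
        have : x + y = ⊥ ↔ x = ⊥ ∧ y = ⊥ := sup_eq_bot_iff (α := JoinSemimodule M)
        simp only [this]
        by_cases hx : x = ⊥ <;> by_cases hy : y = ⊥ <;>
          simp only [hx, hy, add_self, and_false, and_true, and_self, if_true, if_false,
            add_zero, zero_add] }
  map_zero' := by
    ext x
    exact ite_self _
  map_add' a b := by
    ext x
    change (if x = ⊥ then 0 else a + b) = (if x = ⊥ then 0 else a) + (if x = ⊥ then 0 else b)
    split_ifs <;> simp

open Classical in
theorem constEnd_apply (c x : JoinSemimodule M) : constEnd c x = if x = ⊥ then 0 else c := rfl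

theorem constEnd_apply_of_ne {c x : JoinSemimodule M} (hx : x ≠ ⊥) : constEnd c x = c :=
  if_neg hx

theorem mul_constEnd (g : EndSemiring M) (c : JoinSemimodule M) :
    g * constEnd c = constEnd (g c) := by
  ext x
  simp only [Module.End.mul_apply, constEnd_apply, apply_ite g, map_zero]

open Classical in
/-- The idempotent endomorphism sending the elements above `j` to `j` and the others to `0`, for
sup-prime `j`. -/
noncomputable def primeEnd (j : JoinSemimodule M) : EndSemiring M :=
  AddMonoidHom.toBoolLinearMap
    { toFun x := if SupPrime j ∧ j ≤ x then j else 0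
      map_zero' := if_neg fun h => h.1.ne_bot (le_bot_iff.1 h.2)
      map_add' x y := by
        by_cases hj : SupPrime j
        · have : j ≤ x + y ↔ j ≤ x ∨ j ≤ y := hj.le_sup
          by_cases hx : j ≤ x <;> by_cases hy : j ≤ y <;> 
            simp only [this, hj, hx, hy, add_self, true_and, or_true, true_or, or_self, if_true,
              if_false, add_zero, zero_add]
        · simp only [hj, false_and, if_false, add_zero] }

open Classical in
theorem primeEnd_apply (j x : JoinSemimodule M) :
    primeEnd j x = if SupPrime j ∧ j ≤ x then j else 0 := rfl

/-- The sum may run over all `j`, since `primeEnd j` is zero when `j` is not sup-prime. -/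
theorem sum_primeEnd [Fintype (JoinSemimodule M)] :
    ∑ j : JoinSemimodule M, (primeEnd j : EndSemiring M) = 1 := by
  ext x
  rw [LinearMap.sum_apply]
  simp only [primeEnd_apply]
  exact sum_supPrime_and_le (fun _ _ => rfl) rfl x

theorem constEnd_mul_primeEnd (g : EndSemiring M) (j : JoinSemimodule M) :
    constEnd (g j) * primeEnd j = g * primeEnd j := by
  ext x
  simp only [Module.End.mul_apply, primeEnd_apply]
  split_ifs with h
  · exact constEnd_apply_of_ne h.1.ne_bot
  · simp

/-- This writes `g` as a right combination of constants, so right-linear maps on `End(M)` are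
determined by their values on constants. -/
theorem sum_constEnd_mul_primeEnd [Fintype (JoinSemimodule M)] (g : EndSemiring M) :
    ∑ j, constEnd (g j) * primeEnd j = g := by
  simp only [constEnd_mul_primeEnd, ← Finset.mul_sum, sum_primeEnd, mul_one]

/-- The right congruence on the endomorphism semiring induced by a congruence on the semimodule. -/
def endCon (θ : ModuleCon BoolSemiring (JoinSemimodule M)) :
    ModuleCon (EndSemiring M)ᵐᵒᵖ (EndSemiring M) where
  r f g := ∀ x, θ.mkQ (f x) = θ.mkQ (g x)
  iseqv := ⟨fun _ _ => rfl, fun h x => (h x).symm, fun h h' x => (h x).trans (h' x)⟩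
  add' h h' x := by simp only [LinearMap.add_apply, map_add, h x, h' x]
  smul s _ _ h x := h (s.unop x)

/-- If the endomorphism semiring is right CP, then all quotients of the semimodule are retracts. -/
theorem isDistribLatticeUnderAdd_quotient [Finite M] (h : IsRightCPSemiring (EndSemiring M))
    (θ : ModuleCon BoolSemiring (JoinSemimodule M)) : IsDistribLatticeUnderAdd θ.Quotient := by
  have hproj : Module.Projective (EndSemiring M)ᵐᵒᵖ (endCon θ).Quotient :=
    h _ ⟨(endCon θ).mkQ, (endCon θ).mkQ_surjective⟩
  obtain ⟨s, hs⟩ := Module.projective_lifting_property (endCon θ).mkQ LinearMap.id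
    (endCon θ).mkQ_surjective
  have hs' : ∀ g x, θ.mkQ (s ((endCon θ).mkQ g) x) = θ.mkQ (g x) := fun g =>
    (endCon θ).mkQ_eq_iff.1 (LinearMap.congr_fun hs ((endCon θ).mkQ g))
  -- Evaluation at the top element recovers `c` from `constEnd c`, even when `M` is trivial.
  obtain ⟨t, ht⟩ : ∃ t : JoinSemimodule M, ∀ x, x ≤ t := by
    cases nonempty_fintype (JoinSemimodule M)
    exact ⟨Finset.univ.sup id, fun x => Finset.le_sup (f := id) (Finset.mem_univ x)⟩
  have hconst : ∀ c : JoinSemimodule M, constEnd c t = c := by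
    intro c
    by_cases h0 : t = ⊥
    · have : c = ⊥ := le_bot_iff.1 (h0 ▸ ht c)
      rw [constEnd_apply, if_pos h0, this]
      rfl
    · exact constEnd_apply_of_ne h0
  -- A section of `M → M/θ`: lift the class of `constEnd c` through `s`, then evaluate at the top.
  let φ : θ.Quotient →+ JoinSemimodule M :=
    { toFun := Quotient.lift (s := θ.toSetoid)
        (fun c => s ((endCon θ).mkQ (constEnd c)) t) fun c d hcd => by
          have : (endCon θ).mkQ (constEnd c) = (endCon θ).mkQ (constEnd d) := by
            refine (endCon θ).mkQ_eq_iff.2 fun x => ?_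
            simp only [constEnd_apply, apply_ite θ.mkQ, θ.mkQ_eq_iff.2 hcd]
          simp only [this]
      map_zero' := by
        change s ((endCon θ).mkQ (constEnd 0)) t = 0
        simp
      map_add' := by
        rintro ⟨c⟩ ⟨d⟩
        change s ((endCon θ).mkQ (constEnd (c + d))) t =
          s ((endCon θ).mkQ (constEnd c)) t + s ((endCon θ).mkQ (constEnd d)) t
        simp }
  refine HasAddRefinement.isDistribLatticeUnderAdd ?_
    (hasAddRefinement.of_retract φ θ.mkQ.toAddMonoidHom ?_)
  · rintro ⟨a⟩
    exact congrArg θ.mkQ (add_self a)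
  · rintro ⟨c⟩
    exact (hs' _ t).trans (congrArg θ.mkQ (hconst c))

instance projective_end_self : Module.Projective (EndSemiring M)ᵐᵒᵖ (EndSemiring M) :=
  Module.Projective.of_equiv'
    ({ MulOpposite.opAddEquiv.symm with map_smul' := fun _ _ => rfl } :
      (EndSemiring M)ᵐᵒᵖ ≃ₗ[(EndSemiring M)ᵐᵒᵖ] EndSemiring M)

/-- If all quotients of the semimodule are distributive, then the endomorphism semiring is
right CP. -/
theorem isRightCPSemiring_end [Finite M]
    (h : ∀ θ : ModuleCon BoolSemiring (JoinSemimodule M), IsDistribLatticeUnderAdd θ.Quotient) :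
    IsRightCPSemiring (EndSemiring M) := by
  cases nonempty_fintype (JoinSemimodule M)
  rintro A _ _ ⟨f, hf⟩
  have hmul : ∀ g k : EndSemiring M, f (g * k) = MulOpposite.op k • f g := fun g k => by
    rw [← map_smul, op_smul_eq_mul]
  let θ : ModuleCon BoolSemiring (JoinSemimodule M) :=
    { r c d := f (constEnd c) = f (constEnd d)
      iseqv := ⟨fun _ => rfl, fun h => h.symm, fun h h' => h.trans h'⟩
      add' h h' := by simp only [map_add, h, h']
      smul b x y hxy := by
        cases b
        · rfl
        · exact hxy }
  have hθ : ∀ {c d}, θ.mkQ c = θ.mkQ d ↔ f (constEnd c) = f (constEnd d) := θ.mkQ_eq_iff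
  -- The kernel of `f` is the pointwise congruence induced by `θ`: one direction multiplies by
  -- constants on the right, the other uses the decomposition over sup-primes.
  have hf_eq : ∀ g g' : EndSemiring M, f g = f g' ↔ ∀ x, θ.mkQ (g x) = θ.mkQ (g' x) := by
    refine fun g g' => ⟨fun hg x => ?_, fun hg => ?_⟩
    · rw [hθ, ← mul_constEnd, ← mul_constEnd, hmul, hmul, hg]
    · rw [← sum_constEnd_mul_primeEnd g, ← sum_constEnd_mul_primeEnd g', map_sum, map_sum]
      exact Finset.sum_congr rfl fun j _ => by rw [hmul, hmul, hθ.1 (hg j)]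
  obtain ⟨φ, hφ⟩ := (h θ).exists_addMonoidHom_section add_self θ.mkQ.toAddMonoidHom
    θ.mkQ_surjective
  -- `p` picks a canonical representative of each `θ`-class. Left multiplication by `p` commutes
  -- with the right action and depends only on `f g`, so it yields a section of `f`.
  let p : EndSemiring M := φ.toBoolLinearMap ∘ₗ θ.mkQ
  have hp : ∀ g : EndSemiring M, f (p * g) = f g := fun g =>
    (hf_eq _ _).2 fun x => hφ (θ.mkQ (g x))
  have hp' : ∀ {g g' : EndSemiring M}, f g = f g' → p * g = p * g' := fun {g g'} hg =>
    LinearMap.ext fun x => congrArg φ ((hf_eq g g').1 hg x)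
  obtain ⟨r, hr⟩ := hf.hasRightInverse
  let s : A →ₗ[(EndSemiring M)ᵐᵒᵖ] (EndSemiring M) :=
    { toFun a := p * r a
      map_add' a b := by
        rw [← mul_add]
        exact hp' (by rw [map_add, hr, hr, hr])
      map_smul' k a := by
        change _ = p * (r a * k.unop)
        exact hp' (by rw [hmul, hr, hr]; rfl) }
  exact Module.Projective.of_split s f (LinearMap.ext fun a => (hp (r a)).trans (hr a))

end JoinSemimodule

/-! ### Distributive quotients and uniqueness of incomparable elements -/

/-- Every element of `M` is incomparable to at most one element. -/
def IncomparableUnique (M : Type*) [LE M] : Prop :=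
  ∀ ⦃x y z : M⦄, IncompRel (· ≤ ·) x y → IncompRel (· ≤ ·) x z → y = z

namespace JoinSemimodule

variable {M : Type u} [DistribLattice M] [OrderBot M]

theorem isDistribLatticeUnderAdd_quotient_of_incomparableUnique [Finite M]
    (h : IncomparableUnique M) (θ : ModuleCon BoolSemiring (JoinSemimodule M)) :
    IsDistribLatticeUnderAdd θ.Quotient := by
  have hidem : ∀ a : θ.Quotient, a + a = a := by
    rintro ⟨a⟩
    exact congrArg θ.mkQ (add_self a)
  have mono : ∀ {a b : JoinSemimodule M}, a ≤ b → θ.mkQ a + θ.mkQ b = θ.mkQ b :=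
    fun hab => by rw [← map_add, add_eq_right.2 hab]
  refine HasAddRefinement.isDistribLatticeUnderAdd hidem fun X A B hX => ?_
  obtain ⟨x, rfl⟩ := θ.mkQ_surjective X
  obtain ⟨a, rfl⟩ := θ.mkQ_surjective A
  obtain ⟨b, rfl⟩ := θ.mkQ_surjective B
  -- Any comparability `x ≤ a`, `x ≤ b`, `a ≤ b` or `b ≤ a` makes the refinement trivial. Otherwise
  -- `a` and `b` are incomparable, and uniqueness forces both below `x`, so the class of `x` is that
  -- of `a ⊔ b`.
  by_cases hxa : x ≤ a
  · exact ⟨θ.mkQ x, 0, (add_zero _).symm, mono hxa, zero_add _⟩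
  by_cases hxb : x ≤ b
  · exact ⟨0, θ.mkQ x, (zero_add _).symm, zero_add _, mono hxb⟩
  by_cases hab : a ≤ b
  · rw [mono hab] at hX
    exact ⟨0, θ.mkQ x, (zero_add _).symm, zero_add _, hX⟩
  by_cases hba : b ≤ a
  · rw [add_comm (θ.mkQ a), mono hba] at hX
    exact ⟨θ.mkQ x, 0, (add_zero _).symm, hX, zero_add _⟩
  by_cases hax : a ≤ x
  · by_cases hbx : b ≤ x
    · refine ⟨θ.mkQ a, θ.mkQ b, ?_, hidem _, hidem _⟩
      rw [← hX, ← map_add, ← map_add, add_comm x]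
      exact (mono (sup_le hax hbx : a + b ≤ x)).symm.trans (map_add θ.mkQ _ _).symm
    · exact (hxa (h ⟨hba, hab⟩ ⟨hbx, hxb⟩).ge).elim
  · exact (hxb (h ⟨hab, hba⟩ ⟨hax, hxa⟩).ge).elim

/-- The congruence identifying elements which lie below the same elements of `C`. -/
def upperCon (C : Set (JoinSemimodule M)) : ModuleCon BoolSemiring (JoinSemimodule M) where
  r a b := ∀ c ∈ C, a ≤ c ↔ b ≤ c
  iseqv := ⟨fun _ _ _ => Iff.rfl, fun h c hc => (h c hc).symm,
    fun h h' c hc => (h c hc).trans (h' c hc)⟩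
  add' {w x y z} h h' c hc := by
    change w ⊔ y ≤ c ↔ x ⊔ z ≤ c
    rw [sup_le_iff, sup_le_iff, h c hc, h' c hc]
  smul b x y h := by
    cases b
    · exact fun _ _ => Iff.rfl
    · exact h

/-- A pentagon with distinct `y < z` on one side obstructs distributivity of a quotient. -/
theorem false_of_pentagon
    (h : ∀ θ : ModuleCon BoolSemiring (JoinSemimodule M), IsDistribLatticeUnderAdd θ.Quotient)
    {x y z : JoinSemimodule M} (hyz : y < z) (hxz : ¬ x ≤ z) (hyx : ¬ y ≤ x)
    (hinf : x ⊓ z ≤ y) : False := by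
  -- A class is the set of those among `x`, `y`, `z` lying above its members. As `x ⊓ z ≤ y`, only
  -- `∅`, `{x}`, `{z}`, `{y, z}` and `{x, y, z}` occur: the quotient is the pentagon, where `z ≤ x +
  -- y` has no refinement.
  let θ := upperCon {x, y, z}
  have heq : ∀ {a b}, θ.mkQ a = θ.mkQ b ↔ ∀ c ∈ ({x, y, z} : Set _), a ≤ c ↔ b ≤ c :=
    θ.mkQ_eq_iff
  have hzx : ¬ z ≤ x := fun h => hyx (hyz.le.trans h)
  have hxy : ¬ x ≤ y := fun h => hxz (h.trans hyz.le)
  obtain ⟨A, B, h1, h2, h3⟩ := (h θ).hasAddRefinement (θ.mkQ z) (θ.mkQ x) (θ.mkQ y) (by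
    simp only [← map_add]
    refine heq.2 fun c hc => ?_
    change z ⊔ (x ⊔ y) ≤ c ↔ x ⊔ y ≤ c
    simp only [sup_le_iff]
    rcases hc with rfl | rfl | rfl <;> tauto)
  obtain ⟨a, rfl⟩ := θ.mkQ_surjective A
  obtain ⟨b, rfl⟩ := θ.mkQ_surjective B
  rw [← map_add, heq] at h1 h2 h3
  have hax : a ≤ x := le_sup_left.trans ((h2 x (by simp)).2 le_rfl)
  have hby : b ≤ y := le_sup_left.trans ((h3 y (by simp)).2 le_rfl)
  have hab : a ⊔ b ≤ z := (h1 z (by simp)).1 le_rfl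
  have hay : a ≤ y := (le_inf hax (le_sup_left.trans hab)).trans hinf
  exact hyz.not_ge ((h1 y (by simp)).2 (sup_le hay hby))

/-- If `x ⊓ z ≤ y` fails, then `y` against the chain `x ⊓ z < x` is a pentagon configuration
instead. -/
theorem false_of_incompRel_of_lt
    (h : ∀ θ : ModuleCon BoolSemiring (JoinSemimodule M), IsDistribLatticeUnderAdd θ.Quotient)
    {x y z : JoinSemimodule M} (hyz : y < z) (hxz : ¬ x ≤ z) (hyx : ¬ y ≤ x) : False := by
  by_cases hinf : x ⊓ z ≤ y
  · exact false_of_pentagon h hyz hxz hyx hinf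
  · exact false_of_pentagon h (x := y) (y := x ⊓ z) (z := x)
      (inf_le_left.lt_of_ne fun h => hxz (inf_eq_left.1 h)) hyx hinf
      (le_inf inf_le_right (inf_le_left.trans hyz.le))

theorem incomparableUnique_of_quotient
    (h : ∀ θ : ModuleCon BoolSemiring (JoinSemimodule M), IsDistribLatticeUnderAdd θ.Quotient) :
    IncomparableUnique M := by
  intro x y z hxy hxz
  by_contra hne
  by_cases h1 : y ≤ z
  · exact false_of_incompRel_of_lt h (x := x) (y := y) (z := z) (h1.lt_of_ne hne) hxz.1 hxy.2
  by_cases h2 : z ≤ y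
  · exact false_of_incompRel_of_lt h (x := x) (y := z) (z := y)
      (h2.lt_of_ne (Ne.symm hne)) hxy.1 hxz.2
  -- Here `x`, `y`, `z` form an antichain, and a chain incomparable to a third element is needed. If
  -- `z ≤ x ⊔ y`, distributivity forbids `y ⊓ z ≤ x`, so `y ⊓ z < y` serves against `x`; otherwise
  -- `x < x ⊔ y` serves against `z`.
  by_cases h3 : z ≤ x ⊔ y
  · by_cases h4 : y ⊓ z ≤ x
    · refine hxz.2 ?_
      rw [← inf_eq_left.2 h3, inf_sup_left]
      exact sup_le inf_le_right (inf_comm y z ▸ h4)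
    · exact false_of_incompRel_of_lt h (x := x) (y := y ⊓ z) (z := y)
        (inf_le_left.lt_of_ne fun h => h1 (inf_eq_left.1 h)) hxy.1 h4
  · exact false_of_incompRel_of_lt h (x := z) (y := x) (z := x ⊔ y)
      (le_sup_left.lt_of_ne fun h => hxy.2 (sup_eq_left.1 h.symm)) h3 hxz.1

end JoinSemimodule

/-! ### Intervals between consecutive elements of `T(M)` -/

section Chain

variable {M : Type u} [DistribLattice M]

theorem mem_comparableElements_iff {m : M} :
    m ∈ comparableElements M ↔ ∀ x, ¬ IncompRel (· ≤ ·) m x := by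
  refine forall_congr' fun x => ?_
  simp only [IncompRel]
  tauto

/-- An `x` not above `a ⊓ b` is above neither `a` nor `b`. Were it incomparable to one of them, it
would equal the other; hence it is below both. -/
theorem IncomparableUnique.inf_mem (h : IncomparableUnique M) {a b : M}
    (hab : IncompRel (· ≤ ·) a b) : a ⊓ b ∈ comparableElements M := by
  intro x
  by_cases hax : a ≤ x
  · exact Or.inr (inf_le_left.trans hax)
  by_cases hbx : b ≤ x
  · exact Or.inr (inf_le_right.trans hbx)
  by_cases hxa : x ≤ a
  · by_cases hxb : x ≤ b
    · exact Or.inl (le_inf hxa hxb)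
    · exact absurd (h hab.symm ⟨hbx, hxb⟩).le hax
  · exact absurd (h hab ⟨hax, hxa⟩).le hbx

theorem IncomparableUnique.sup_mem (h : IncomparableUnique M) {a b : M}
    (hab : IncompRel (· ≤ ·) a b) : a ⊔ b ∈ comparableElements M := by
  intro x
  by_cases hxa : x ≤ a
  · exact Or.inl (hxa.trans le_sup_left)
  by_cases hxb : x ≤ b
  · exact Or.inl (hxb.trans le_sup_right)
  by_cases hax : a ≤ x
  · by_cases hbx : b ≤ x
    · exact Or.inr (sup_le hax hbx)
    · exact absurd (h hab.symm ⟨hbx, hxb⟩).ge hxa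
  · exact absurd (h hab ⟨hax, hxa⟩).ge hxb

/-- If `b` were not in the interval, `t` or `t'` would lie between `a` and `b` and make them
comparable. -/
theorem mem_Icc_of_incompRel {a b t t' : M} (ht : t ∈ comparableElements M)
    (ht' : t' ∈ comparableElements M) (ha : a ∈ Set.Icc t t') (hab : IncompRel (· ≤ ·) a b) :
    b ∈ Set.Icc t t' :=
  ⟨(ht b).resolve_left fun h => hab.2 (h.trans ha.1),
    (ht' b).resolve_right fun h => hab.1 (ha.2.trans h)⟩

/-- An interval consisting of two incomparable elements, their meet and their join is a square. -/
theorem nonempty_orderIso_of_incompRel {a b : M} (hab : IncompRel (· ≤ ·) a b)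
    (h : ∀ c ∈ Set.Icc (a ⊓ b) (a ⊔ b), c = a ⊓ b ∨ c = a ∨ c = b ∨ c = a ⊔ b) :
    Nonempty (Set.Icc (a ⊓ b) (a ⊔ b) ≃o Bool × Bool) := by
  classical
  have hle : a ⊓ b ≤ a ⊔ b := inf_le_left.trans le_sup_left
  let f : Set.Icc (a ⊓ b) (a ⊔ b) → Bool × Bool := fun c => (decide (a ≤ c), decide (b ≤ c))
  have hf : ∀ c d, f c ≤ f d ↔ c ≤ d := by
    rintro ⟨c, hc⟩ ⟨d, hd⟩
    have key : f ⟨c, hc⟩ ≤ f ⟨d, hd⟩ ↔ (a ≤ c → a ≤ d) ∧ (b ≤ c → b ≤ d) := by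
      simp [f, Prod.le_def, Bool.le_iff_imp]
    rw [key, Subtype.mk_le_mk]
    refine ⟨fun ⟨h1, h2⟩ => ?_, fun hcd => ⟨fun h => h.trans hcd, fun h => h.trans hcd⟩⟩
    rcases h c hc with rfl | rfl | rfl | rfl
    · exact hd.1
    · exact h1 le_rfl
    · exact h2 le_rfl
    · exact sup_le (h1 le_sup_left) (h2 le_sup_right)
  let e : Set.Icc (a ⊓ b) (a ⊔ b) ↪o Bool × Bool := OrderEmbedding.ofMapLEIff f hf
  have hsurj : Function.Surjective e := by
    rintro ⟨_ | _, _ | _⟩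
    · exact ⟨⟨a ⊓ b, le_rfl, hle⟩, by simp [e, f, hab.1, hab.2]⟩
    · exact ⟨⟨b, inf_le_right, le_sup_right⟩, by simp [e, f, hab.1]⟩
    · exact ⟨⟨a, inf_le_left, le_sup_left⟩, by simp [e, f, hab.2]⟩
    · exact ⟨⟨a ⊔ b, hle, le_rfl⟩, by simp [e, f]⟩
  exact ⟨RelIso.ofSurjective e hsurj⟩

theorem IncomparableUnique.Icc_eq_or_square (h : IncomparableUnique M) {t t' : M}
    (ht : t ∈ comparableElements M) (ht' : t' ∈ comparableElements M)
    (hT : Set.Icc t t' ∩ comparableElements M = {t, t'}) :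
    Set.Icc t t' = {t, t'} ∨ Nonempty (Set.Icc t t' ≃o Bool × Bool) := by
  by_cases hall : Set.Icc t t' ⊆ comparableElements M
  · exact Or.inl (by rwa [Set.inter_eq_left.2 hall] at hT)
  right
  obtain ⟨a, ha, haT⟩ := Set.not_subset.1 hall
  obtain ⟨b, hab⟩ : ∃ b, IncompRel (· ≤ ·) a b := by
    simpa only [mem_comparableElements_iff, not_forall, not_not] using haT
  have hb := mem_Icc_of_incompRel ht ht' ha hab
  -- The meet and join of `a` and `b` lie in both `T(M)` and the interval, so they can only be its
  -- endpoints.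
  have hinf : a ⊓ b = t := by
    have : a ⊓ b ∈ ({t, t'} : Set M) :=
      hT ▸ ⟨⟨le_inf ha.1 hb.1, inf_le_left.trans ha.2⟩, h.inf_mem hab⟩
    refine this.resolve_right fun h' => hab.1 ?_
    exact ha.2.trans (h'.ge.trans inf_le_right)
  have hsup : a ⊔ b = t' := by
    have : a ⊔ b ∈ ({t, t'} : Set M) :=
      hT ▸ ⟨⟨ha.1.trans le_sup_left, sup_le ha.2 hb.2⟩, h.sup_mem hab⟩
    refine this.resolve_left fun h' => hab.1 ?_
    exact le_sup_left.trans (h'.le.trans hb.1)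
  subst hinf hsup
  refine nonempty_orderIso_of_incompRel hab fun c hc => ?_
  by_cases hca : IncompRel (· ≤ ·) a c
  · exact Or.inr (Or.inr (Or.inl (h hab hca).symm))
  by_cases hcb : IncompRel (· ≤ ·) b c
  · exact Or.inr (Or.inl (h hab.symm hcb).symm)
  by_cases h1 : a ≤ c
  · by_cases h2 : b ≤ c
    · exact Or.inr (Or.inr (Or.inr (hc.2.antisymm (sup_le h1 h2))))
    · have h3 : c ≤ b := by_contra fun h3 => hcb ⟨h2, h3⟩
      exact absurd (h1.trans h3) hab.1
  · have h3 : c ≤ a := by_contra fun h3 => hca ⟨h1, h3⟩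
    by_cases h2 : b ≤ c
    · exact absurd (h2.trans h3) hab.2
    · have h4 : c ≤ b := by_contra fun h4 => hcb ⟨h2, h4⟩
      exact Or.inl ((le_inf h3 h4).antisymm hc.1)

theorem incomparableUnique_bool_prod : IncomparableUnique (Bool × Bool) := by
  unfold IncomparableUnique IncompRel
  decide

/-- Take the largest element of `T(M)` below `a` and the smallest above; both exist since `T(M)`
contains bottom and top and is finite. -/
theorem exists_comparable_Icc [OrderBot M] [Finite M] (a : M) :
    ∃ t ∈ comparableElements M, ∃ t' ∈ comparableElements M, a ∈ Set.Icc t t' ∧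
      Set.Icc t t' ∩ comparableElements M = {t, t'} := by
  obtain ⟨m, hm⟩ : ∃ m : M, ∀ x, x ≤ m := by
    cases nonempty_fintype M
    exact ⟨Finset.univ.sup id, fun x => Finset.le_sup (f := id) (Finset.mem_univ x)⟩
  obtain ⟨t, ⟨htT, hta⟩, htmax⟩ :=
    (Set.toFinite {t | t ∈ comparableElements M ∧ t ≤ a}).exists_maximal
    ⟨⊥, fun x => Or.inr bot_le, bot_le⟩
  obtain ⟨t', ⟨htT', hta'⟩, htmin⟩ :=
    (Set.toFinite {t | t ∈ comparableElements M ∧ a ≤ t}).exists_minimal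
    ⟨m, fun x => Or.inl (hm x), hm a⟩
  refine ⟨t, htT, t', htT', ⟨hta, hta'⟩, Set.Subset.antisymm ?_ ?_⟩
  · rintro u ⟨hu, huT⟩
    rcases (huT a).symm with hua | hua
    · exact Or.inl ((htmax ⟨huT, hua⟩ hu.1).antisymm hu.1)
    · exact Or.inr (hu.2.antisymm (htmin ⟨huT, hua⟩ hu.2))
  · rintro u (rfl | rfl)
    · exact ⟨⟨le_rfl, hta.trans hta'⟩, htT⟩
    · exact ⟨⟨hta.trans hta', le_rfl⟩, htT'⟩

/-- Everything incomparable to `a` lies in the same interval between consecutive elements of `T(M)`,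
so uniqueness need only be checked in the four-element square. -/
theorem incomparableUnique_of_Icc [OrderBot M] [Finite M]
    (h : ∀ t ∈ comparableElements M, ∀ t' ∈ comparableElements M, t ≤ t' →
      Set.Icc t t' ∩ comparableElements M = {t, t'} →
        Set.Icc t t' = {t, t'} ∨ Nonempty (Set.Icc t t' ≃o Bool × Bool)) :
    IncomparableUnique M := by
  intro a y z hy hz
  have haT : a ∉ comparableElements M := fun ha => mem_comparableElements_iff.1 ha y hy
  obtain ⟨t, ht, t', ht', ha, hT⟩ := exists_comparable_Icc a
  rcases h t ht t' ht' (ha.1.trans ha.2) hT with heq | ⟨⟨e⟩⟩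
  · rw [heq] at hT
    have : a ∈ ({t, t'} : Set M) := heq ▸ ha
    exact absurd (Set.inter_eq_left.1 hT this) haT
  · have hy' := mem_Icc_of_incompRel ht ht' ha hy
    have hz' := mem_Icc_of_incompRel ht ht' ha hz
    have := incomparableUnique_bool_prod (x := e ⟨a, ha⟩) (y := e ⟨y, hy'⟩) (z := e ⟨z, hz'⟩)
      (by simpa [IncompRel] using hy) (by simpa [IncompRel] using hz)
    exact congrArg Subtype.val (e.injective this)

end Chain

theorem theorem5p9 (M : Type u) [DistribLattice M] [OrderBot M] [Finite M] :
    List.TFAE [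
      IsRightCPSemiring (Module.End BoolSemiring (JoinSemimodule M)),
      ∀ θ : ModuleCon BoolSemiring (JoinSemimodule M), IsDistribLatticeUnderAdd θ.Quotient,
      ∀ t ∈ comparableElements M, ∀ t' ∈ comparableElements M, t ≤ t' →
        Set.Icc t t' ∩ comparableElements M = {t, t'} →
          Set.Icc t t' = {t, t'} ∨ Nonempty (Set.Icc t t' ≃o Bool × Bool)] := by
  tfae_have 1 → 2 := JoinSemimodule.isDistribLatticeUnderAdd_quotient
  tfae_have 2 → 1 := JoinSemimodule.isRightCPSemiring_end
  tfae_have 2 → 3 := fun h _ ht _ ht' _ hT =>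
    (JoinSemimodule.incomparableUnique_of_quotient h).Icc_eq_or_square ht ht' hT
  tfae_have 3 → 2 := fun h =>
    JoinSemimodule.isDistribLatticeUnderAdd_quotient_of_incomparableUnique
      (incomparableUnique_of_Icc h)
  tfae_finish
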